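/- **Setting.** Finitely many electric-vehicle aggregators $i=1,\dots,N$ charge their vehicles during time slots $1,\dots,T$ of length $\Delta t>0$ ($T\ge 1$). Vehicle $v$ of aggregator $i$ has initial and maximal states of charge $S_{v,\mathrm{init}}\le S_{v,\max}$, demand $e_v=S_{v,\max}-S_{v,\mathrm{init}}$ and maximal charging rate $R_v>0$; it is assumed that $e_v/(R_v\Delta t)\le T$. Put $E_i=\sum_v e_v$, $\tau_i=\max_v e_v/(R_v\Delta t)$ (with $\tau_i=0$ if $i$ has no vehicles), and let $\mathcal I_i=\{t\in\{1,\dots,T\}: t\le T-\tau_i+1\}$ be the set of possible start times, $\mathcal I=\prod_i\mathcal I_i$. If aggregator $i$ starts in slot $t_i$, its feasible charging profiles are the $x_i\in\mathbb R^T$ with $x_{i,t}=0$ for $t<t_i$, $\sum_t\eta_i x_{i,t}=E_i$ and $0\le \eta_i x_{i,t}/\Delta t\le\sum_v R_v$ for all $t$, where $0<\eta_i\le1$. Its payoff is $$U_i=-\sum_{t=t_i}^{T}\bigl(p_t x_{i,t}+D_{i,t}\bigr),\qquad p_t=\phi_t\Bigl(L_{b,t}+\sum_{j=1}^N x_{j,t}\Bigr)+\delta_t,$$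 where $D_{i,t}=g_{i,t}(\bar x_{i,t}-x_{i,t})^2$ if $x_{i,t}<\bar x_{i,t}$ and $D_{i,t}=0$ otherwise, $\bar x_{i,t}=\bigl(E_i-\sum_{s=t_i}^{t-1}x_{i,s}\bigr)/(T-t+1)$, and $L_{b,t},\phi_t,\delta_t,g_{i,t}>0$. **Games.** In the two-stage game $\Upsilon$ the aggregators first choose start times simultaneously; after observing $\sigma=(t_1,\dots,t_N)\in\mathcal I$ they simultaneously choose feasible charging profiles (the subgame $G_\sigma$) and receive the payoffs $U_i$. A mixed strategy of $i$ in $\Upsilon$ is a probability vector $a_i$ on $\mathcal I_i$ together with a feasible charging profile for each $\sigma\in\mathcal I$. The game $\Phi$ is the first-stage game in which $\sigma\in\mathcal I$ gives aggregator $i$ the payoff $F_i(\sigma)$ that it receives at the pure Nash equilibrium $x^*(\sigma)$ of $G_\sigma$; a mixed strategy in $\Phi$ is a probability vector $a_i$ on $\mathcal I_i$. **Evaluation of mixed strategies.** Let $F_i(\sigma)$ be the payoff of $i$ after $\sigma$ (in $\Upsilon$: the payoff $U_i$ resulting from the charging plans in use). Under expected utility theory $i$ evaluates $a=(a_1,\dots,a_N)$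 by $\sum_{\sigma\in\mathcal I}F_i(\sigma)\prod_j a_j(t_j)$. Under prospect theory $i$ evaluates it by $\sum_{\sigma\in\mathcal I}F_i(\sigma)\,a_i(t_i)\prod_{j\ne i}w_i(a_j(t_j))$, with Prelec's weighting $w_i(p)=\exp(-(-\ln p)^{\alpha_i})$ for $0<p\le 1$, $w_i(0)=0$, and $0<\alpha_i\le1$. **$\epsilon$-equilibria.** A profile is an $\epsilon$-Nash equilibrium if no player can gain more than $\epsilon$ by a unilateral deviation. A mixed strategy profile of $\Upsilon$ is a subgame perfect $\epsilon$-Nash equilibrium if it is an $\epsilon$-Nash equilibrium of $\Upsilon$ and induces an $\epsilon$-Nash equilibrium in every subgame $G_\sigma$, $\sigma\in\mathcal I$. **Statement.** Each $G_\sigma$ has a unique pure Nash equilibrium $x^*(\sigma)$, so that $\Phi$ is well defined. Moreover, under expected utility theory, and likewise under prospect theory for any parameters $\alpha_i\in(0,1]$, the following holds for every $\epsilon>0$: 1. if $\hat a$ is a mixed strategy $\epsilon$-Nash equilibrium of $\Phi$, then playing $\hat a$ at the first stage and $x^*(\sigma)$ after every $\sigma\in\mathcal I$ is a mixed strategy subgame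 perfect $\epsilon$-Nash equilibrium of $\Upsilon$; 2. $\Phi$ has a mixed strategy $\epsilon$-Nash equilibrium, and hence $\Upsilon$ has a mixed strategy subgame perfect $\epsilon$-Nash equilibrium. -/

import Mathlib

open Finset

/-! ### Finite-player games -/

/-- `s` is an `ε`-Nash equilibrium of the game with players `Fin n`, strategy sets `A i` and
payoffs `u i`: no player gains more than `ε` by a unilateral deviation. -/
def IsEpsNash {n : ℕ} {A : Fin n → Type} (u : Fin n → (∀ j, A j) → ℝ) (ε : ℝ)
    (s : ∀ j, A j) : Prop :=
  ∀ (i : Fin n) (s' : A i), u i s ≥ u i (Function.update s i s') - ε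

/-- Nash equilibrium. -/
def IsNash {n : ℕ} {A : Fin n → Type} (u : Fin n → (∀ j, A j) → ℝ) (s : ∀ j, A j) : Prop :=
  ∀ (i : Fin n) (s' : A i), u i s ≥ u i (Function.update s i s')

/-! ### Evaluation of randomized first-stage choices -/

/-- Prelec's probability weighting function `exp (-(-ln p) ^ α)` on `[0, 1]`, with the limit
value `0` at `p = 0`. -/
noncomputable def prelec (α p : ℝ) : ℝ :=
  if p = 0 then 0 else Real.exp (-((-Real.log p) ^ α))

/-- How the players evaluate lotteries: by expected utility, or by prospect theory with
Prelec parameters `α i ∈ (0, 1]`. -/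
inductive UserModel (n : ℕ) : Type
  | expectedUtility : UserModel n
  | prospect (α : Fin n → ℝ) (hα : ∀ i, 0 < α i ∧ α i ≤ 1) : UserModel n

/-- The value for player `i` of the payoff function `F` on pure profiles, when the players use
the mixed strategies `a`. Under prospect theory player `i` weights the probabilities of the
other players' actions and takes the probabilities of their own actions at face value. -/
noncomputable def UserModel.value {n : ℕ} (m : UserModel n) {I : Fin n → Type}
    [∀ i, Fintype (I i)] (i : Fin n) (F : (∀ j, I j) → ℝ)
    (a : ∀ j, stdSimplex ℝ (I j)) : ℝ :=
  match m with
  | .expectedUtility => ∑ σ : (∀ j, I j), F σ * ∏ j, (a j).1 (σ j)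
  | .prospect α _ => ∑ σ : (∀ j, I j),
      F σ * ((a i).1 (σ i) * ∏ j ∈ univ.erase i, prelec (α i) ((a j).1 (σ j)))

/-! ### The charging system -/

/-- The data of the charging system. The time slots `1, …, T` are represented by `Fin T`, so
that `t : Fin T` is slot number `t + 1`. -/
structure EVSystem where
  /-- number of aggregators -/
  N : ℕ
  /-- number of time slots -/
  T : ℕ
  T_pos : 0 < T
  /-- length of a time slot -/
  dt : ℝ
  dt_pos : 0 < dt
  /-- number of vehicles of each aggregator -/
  V : Fin N → ℕ
  /-- initial and maximal state of charge of each vehicle, in units of energy -/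
  socInit : ∀ i, Fin (V i) → ℝ
  socMax : ∀ i, Fin (V i) → ℝ
  soc_le : ∀ i v, socInit i v ≤ socMax i v
  /-- maximal charging rate of each vehicle -/
  R : ∀ i, Fin (V i) → ℝ
  R_pos : ∀ i v, 0 < R i v
  /-- charging efficiencies -/
  eta : Fin N → ℝ
  eta_pos : ∀ i, 0 < eta i
  eta_le_one : ∀ i, eta i ≤ 1
  /-- base load -/
  baseLoad : Fin T → ℝ
  baseLoad_pos : ∀ t, 0 < baseLoad t
  /-- tariff constants: the unit price at load `L` is `phi t * L + delta t` -/
  phi : Fin T → ℝ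
  phi_pos : ∀ t, 0 < phi t
  delta : Fin T → ℝ
  delta_pos : ∀ t, 0 < delta t
  /-- weights of the deviation costs -/
  g : Fin N → Fin T → ℝ
  g_pos : ∀ i t, 0 < g i t
  /-- each vehicle can be fully charged within the horizon -/
  chargeable : ∀ i v, (socMax i v - socInit i v) / (R i v * dt) ≤ T

namespace EVSystem

variable (S : EVSystem)

/-- Energy demand of a vehicle. -/
def vehicleDemand (i : Fin S.N) (v : Fin (S.V i)) : ℝ := S.socMax i v - S.socInit i v

/-- Energy demand `E_i` of an aggregator. -/
def demand (i : Fin S.N) : ℝ := ∑ v, S.vehicleDemand i v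

/-- The number `τ_i` of slots needed when all vehicles charge at their maximal rates. -/
noncomputable def minSlots (i : Fin S.N) : ℝ := ⨆ v, S.vehicleDemand i v / (S.R i v * S.dt)

/-- The set `{1, …, T - τ_i + 1} ∩ {1, …, T}` of possible start times. -/
noncomputable def startTimes (i : Fin S.N) : Finset (Fin S.T) := by
  classical exact univ.filter fun t => ((t : ℕ) : ℝ) + 1 ≤ (S.T - S.minSlots i) + 1

/-- Start times of aggregator `i`, as a type. -/
abbrev StartTime (i : Fin S.N) : Type := {t : Fin S.T // t ∈ S.startTimes i}

/-- Profiles of start times. -/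
abbrev StartProfile : Type := ∀ i, S.StartTime i

/-- The feasible charging profiles of aggregator `i` who starts in slot `t₀`. A profile is
recorded on all slots and vanishes before `t₀`. -/
def chargingSet (i : Fin S.N) (t₀ : Fin S.T) : Set (Fin S.T → ℝ) :=
  {x | (∀ t, t < t₀ → x t = 0) ∧ ∑ t, S.eta i * x t = S.demand i ∧
    ∀ t, 0 ≤ S.eta i * x t / S.dt ∧ S.eta i * x t / S.dt ≤ ∑ v, S.R i v}

/-- Second-stage actions of aggregator `i` after the start times `σ`. -/
abbrev Charging (σ : S.StartProfile) (i : Fin S.N) : Type := S.chargingSet i (σ i).1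

/-- Unit price at time `t`, given the charging profiles of all aggregators. -/
def price (x : Fin S.N → Fin S.T → ℝ) (t : Fin S.T) : ℝ :=
  S.phi t * (S.baseLoad t + ∑ i, x i t) + S.delta t

/-- Target consumption of aggregator `i` at a time `t ≥ t₀`. In terms of the slot number
`k = t + 1` the denominator is `(T - k) + 1`. -/
noncomputable def target (i : Fin S.N) (t₀ : Fin S.T) (x : Fin S.T → ℝ) (t : Fin S.T) : ℝ :=
  (S.demand i - ∑ s ∈ Finset.Ico t₀ t, x s) / ((S.T - (((t : ℕ) : ℝ) + 1)) + 1)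

/-- Deviation cost (feasible `x` are nonnegative). -/
noncomputable def deviationCost (i : Fin S.N) (t₀ : Fin S.T) (x : Fin S.T → ℝ)
    (t : Fin S.T) : ℝ :=
  if x t < S.target i t₀ x t then S.g i t * (S.target i t₀ x t - x t) ^ 2 else 0

/-- Total cost `C_i` of aggregator `i`. -/
noncomputable def cost (σ : S.StartProfile) (i : Fin S.N) (x : Fin S.N → Fin S.T → ℝ) : ℝ :=
  ∑ t ∈ Finset.Ici (σ i).1, (S.price x t * x i t + S.deviationCost i (σ i).1 (x i) t)

/-- Payoffs of the second-stage game `G_σ` (the players' strategy sets are `Charging σ i`). -/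
noncomputable def subgamePayoff (σ : S.StartProfile) (i : Fin S.N)
    (x : ∀ j, S.Charging σ j) : ℝ :=
  -S.cost σ i fun j => (x j).1

lemma vehicleDemand_le (i : Fin S.N) (t : S.StartTime i) (v : Fin (S.V i)) :
    S.vehicleDemand i v ≤ S.R i v * S.dt * (S.T - ((t.1 : ℕ) : ℝ)) := by
  have h1 : ((t.1 : ℕ) : ℝ) + 1 ≤ (S.T - S.minSlots i) + 1 := by
    have := t.2
    simp only [startTimes, Finset.mem_filter] at this
    exact this.2
  have h2 : S.vehicleDemand i v / (S.R i v * S.dt) ≤ S.minSlots i :=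
    le_ciSup (f := fun v => S.vehicleDemand i v / (S.R i v * S.dt))
      (Set.finite_range _).bddAbove v
  have h3 : 0 < S.R i v * S.dt := mul_pos (S.R_pos i v) S.dt_pos
  rw [div_le_iff₀ h3] at h2
  nlinarith

/-- Every aggregator has a feasible second-stage action after any start times. -/
instance chargingNonempty (σ : S.StartProfile) (i : Fin S.N) : Nonempty (S.Charging σ i) := by
  set t₀ := (σ i).1 with ht₀
  have hk : 0 < (S.T : ℝ) - ((t₀ : ℕ) : ℝ) := by
    have : (((t₀ : ℕ)) : ℝ) < S.T := by exact_mod_cast t₀.2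
    linarith
  have hη := S.eta_pos i
  have hdt := S.dt_pos
  have hE0 : 0 ≤ S.demand i :=
    Finset.sum_nonneg fun v _ => sub_nonneg.2 (S.soc_le i v)
  have hE1 : S.demand i ≤ (∑ v, S.R i v) * S.dt * ((S.T : ℝ) - ((t₀ : ℕ) : ℝ)) := by
    unfold demand
    rw [Finset.sum_mul, Finset.sum_mul]
    exact Finset.sum_le_sum fun v _ => S.vehicleDemand_le i (σ i) v
  have hR : 0 ≤ ∑ v, S.R i v := Finset.sum_nonneg fun v _ => (S.R_pos i v).le
  refine ⟨⟨fun t => if t < t₀ then 0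
    else S.demand i / (S.eta i * ((S.T : ℝ) - ((t₀ : ℕ) : ℝ))), ?_, ?_, ?_⟩⟩
  · intro t ht
    exact if_pos ht
  · have hc : ((Finset.univ.filter fun t : Fin S.T => ¬ t < t₀).card : ℝ)
        = (S.T : ℝ) - ((t₀ : ℕ) : ℝ) := by
      have : (Finset.univ.filter fun t : Fin S.T => ¬ t < t₀) = Finset.Ici t₀ := by
        ext t; simp
      rw [this, Fin.card_Ici, Nat.cast_sub t₀.2.le]
    simp only [mul_ite, mul_zero]
    rw [Finset.sum_ite, Finset.sum_const_zero, zero_add, Finset.sum_const, nsmul_eq_mul, hc]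
    field_simp
  · intro t
    dsimp only
    split_ifs with h
    · simpa using hR
    · constructor
      · positivity
      · rw [div_le_iff₀ hdt, ← mul_div_assoc, mul_div_mul_left _ _ hη.ne', div_le_iff₀ hk]
        exact hE1

/-- The Nash equilibrium `x*(σ)` of the second-stage game `G_σ`. -/
noncomputable def equilibriumCharging (σ : S.StartProfile) : ∀ j, S.Charging σ j :=
  Classical.epsilon fun x => IsNash (S.subgamePayoff σ) x

/-! ### The first-stage game `Φ` -/

/-- Payoff of the game `Φ` on pure profiles: the equilibrium payoff of `G_σ`. -/
noncomputable def firstStagePayoff (i : Fin S.N) (σ : S.StartProfile) : ℝ :=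
  S.subgamePayoff σ i (S.equilibriumCharging σ)

/-- Mixed strategies of the game `Φ`. -/
abbrev Mixed (i : Fin S.N) : Type := stdSimplex ℝ (S.StartTime i)

/-- Payoffs of the game `Φ` in mixed strategies. -/
noncomputable def mixedPayoff (m : UserModel S.N) (i : Fin S.N) (a : ∀ j, S.Mixed j) : ℝ :=
  m.value i (S.firstStagePayoff i) a

/-! ### The two-stage game `Υ` -/

/-- A mixed strategy of aggregator `i` in the two-stage game: a lottery over the start times,
and a charging profile for each observed profile of start times. -/
structure Strategy (i : Fin S.N) : Type where
  start : S.Mixed i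
  plan : ∀ σ : S.StartProfile, S.Charging σ i

/-- Payoffs of the two-stage game. -/
noncomputable def payoff (m : UserModel S.N) (i : Fin S.N) (s : ∀ j, S.Strategy j) : ℝ :=
  m.value i (fun σ => S.subgamePayoff σ i fun j => (s j).plan σ) fun j => (s j).start

/-- Subgame perfect `ε`-Nash equilibrium of the two-stage game: an `ε`-Nash equilibrium of the
whole game that induces an `ε`-Nash equilibrium in every proper subgame `G_σ`. -/
def IsSubgamePerfectEpsNash (m : UserModel S.N) (ε : ℝ) (s : ∀ j, S.Strategy j) : Prop :=
  IsEpsNash (S.payoff m) ε s ∧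
    ∀ σ : S.StartProfile, IsEpsNash (S.subgamePayoff σ) ε fun j => (s j).plan σ

/-- First-stage lotteries `a`, followed by equilibrium play in every second-stage game. -/
noncomputable def followedByEquilibrium (a : ∀ j, S.Mixed j) (j : Fin S.N) : S.Strategy j :=
  ⟨a j, fun σ => S.equilibriumCharging σ j⟩

end EVSystem

/-!
The second-stage game `G_σ` is an exact potential game. Its potential is continuous on a compact set,
and a minimizer is a Nash equilibrium (`EVSystem.exists_isNash_subgamePayoff`). For uniqueness, each
cost is the sum of a quadratic and the convex deviation cost, so an equilibrium satisfies a
variational inequality (`EVSystem.variational_inequality_of_isNash`). Adding those of two equilibria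
`x`, `y` over all players cancels the deviation costs and leaves
`∑ t, φ t * ((∑ i, (x i t - y i t)) ^ 2 + ∑ i, (x i t - y i t) ^ 2) ≤ 0`, hence `x = y`.

In both models the value of a lottery is a sum of payoffs with nonnegative weights, linear in the
player's own probabilities and continuous in those of the others (`UserModel.exists_weight`).
Nonnegativity lets an `ε`-equilibrium of `Φ` pass to `Υ`: a deviator does best by keeping to the
equilibrium of every `G_σ`, and is then a deviator in `Φ`. Linearity and continuity give an
`ε`-equilibrium of `Φ` from Brouwer's theorem (`UserModel.exists_isEpsNash_value`). The map whose
fixed point is taken sends all of `ℝⁿ` into the product of the simplices, so the form of Brouwer's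
theorem needed is that a bounded continuous self-map of `ℝⁿ` has a fixed point.

This is proved analytically. Let `u` be `C¹` and zero off a ball `B`. For small `t` the map
`x ↦ x + t u(x)` is a bijection of `B`, so for polynomial `q` the change of variables formula
`∫_B q(x + t u(x)) det(1 + t Du(x)) dx = ∫_B q` holds. Both sides are polynomial in `t`, so it holds
for `t = 1`, and if `x + u(x)` had no zero, taking for `q` an approximation of a bump around `0`
would contradict it (`exists_add_eq_zero_of_contDiff`). With `u` a cut-off of a smooth approximation
of `-f`, a zero of `x + u(x)` is an approximate fixed point of `f`.
-/

/-! ### Fixed points of bounded continuous maps -/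

section Brouwer

open MeasureTheory Metric Topology

variable {κ : Type*} [Fintype κ]

/-- A small multiple of a Lipschitz map perturbs the identity to a bijection. -/
lemma LipschitzWith.bijective_id_add_smul {E : Type*} [NormedAddCommGroup E] [NormedSpace ℝ E]
    [CompleteSpace E] {u : E → E} {K : NNReal} (hu : LipschitzWith K u) {t : ℝ}
    (ht : ‖t‖₊ * K < 1) : Function.Bijective fun x => x + t • u x := by
  have hc : ∀ y : E, ContractingWith (‖t‖₊ * K) fun x => y - t • u x := fun y =>
    ⟨ht, LipschitzWith.of_dist_le_mul fun a b => by
      rw [dist_sub_left, dist_smul₀, NNReal.coe_mul, mul_assoc]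
      exact mul_le_mul_of_nonneg_left (hu.dist_le_mul a b) (norm_nonneg t)⟩
  refine ⟨fun a b hab => ?_, fun y => ?_⟩
  · refine (hc (a + t • u a)).fixedPoint_unique' ?_ ?_
    · exact add_sub_cancel_right _ _
    · exact sub_eq_of_eq_add hab
  · refine ⟨ContractingWith.fixedPoint _ (hc y), ?_⟩
    have h : y - t • u _ = _ := (hc y).fixedPoint_isFixedPt
    exact (sub_eq_iff_eq_add.1 h).symm

/-- A bijection that is the identity off a set maps that set onto itself. -/
lemma Function.Bijective.image_eq_of_eqOn_compl {α : Type*} {h : α → α}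
    (hh : Function.Bijective h) {s : Set α} (hs : ∀ x ∉ s, h x = x) : h '' s = s := by
  have h1 : h '' sᶜ = sᶜ := (Set.image_congr hs).trans (Set.image_id' _)
  rw [Set.image_compl_eq hh] at h1
  exact compl_injective h1

/-- For small `t`, the map `x ↦ x + t u(x)` is a diffeomorphism of the ball that carries `u`, and
the change of variables formula holds without an absolute value. -/
lemma eventually_setIntegral_comp_id_add_smul {u : (κ → ℝ) → κ → ℝ} (hu : ContDiff ℝ 1 u) {R : ℝ}
    (hR : ∀ x ∉ closedBall (0 : κ → ℝ) R, u x = 0) :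
    ∀ᶠ t : ℝ in 𝓝 0, ∀ ρ : (κ → ℝ) → ℝ,
      ∫ x in closedBall 0 R, ρ (x + t • u x) *
        (ContinuousLinearMap.id ℝ (κ → ℝ) + t • fderiv ℝ u x).det
      = ∫ x in closedBall 0 R, ρ x := by
  have hcs : HasCompactSupport u :=
    HasCompactSupport.intro (isCompact_closedBall _ _) hR
  obtain ⟨K, hK⟩ := hu.lipschitzWith_of_hasCompactSupport hcs one_ne_zero
  have hsmall : ∀ᶠ t : ℝ in 𝓝 0, ‖t‖₊ * K < 1 := by
    have : Filter.Tendsto (fun t : ℝ => ‖t‖₊ * K) (𝓝 0) (𝓝 (‖(0 : ℝ)‖₊ * K)) :=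
      (Continuous.tendsto (by fun_prop) 0)
    exact this.eventually_lt_const (by simp)
  have hdetc : Continuous fun z : ℝ × (κ → ℝ) =>
      (ContinuousLinearMap.id ℝ (κ → ℝ) + z.1 • fderiv ℝ u z.2).det := by
    have := hu.continuous_fderiv one_ne_zero
    exact ContinuousLinearMap.continuous_det.comp (by fun_prop)
  have hpos : ∀ᶠ t : ℝ in 𝓝 0, ∀ x ∈ closedBall (0 : κ → ℝ) R,
      0 < (ContinuousLinearMap.id ℝ (κ → ℝ) + t • fderiv ℝ u x).det := by
    refine (isCompact_closedBall (0 : κ → ℝ) R).eventually_forall_of_forall_eventually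
      fun y _ => ?_
    refine (hdetc.tendsto (0, y)).eventually_const_lt ?_
    simp [ContinuousLinearMap.det]
  filter_upwards [hsmall, hpos] with t ht htp ρ
  have hb := hK.bijective_id_add_smul ht
  have himg := hb.image_eq_of_eqOn_compl (s := closedBall 0 R)
    fun x hx => by simp [hR x hx]
  have hcv := integral_image_eq_integral_abs_det_fderiv_smul (μ := volume)
    (measurableSet_closedBall (x := (0 : κ → ℝ)) (ε := R))
    (f := fun x => x + t • u x)
    (f' := fun x => ContinuousLinearMap.id ℝ (κ → ℝ) + t • fderiv ℝ u x)
    (fun x _ => ((hasFDerivAt_id x).add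
      ((hu.differentiable one_ne_zero x).hasFDerivAt.const_smul t)).hasFDerivWithinAt)
    (hb.1.injOn) ρ
  rw [himg] at hcv
  rw [hcv]
  refine setIntegral_congr_fun measurableSet_closedBall fun x hx => ?_
  simp only [smul_eq_mul]
  rw [abs_of_pos (htp x hx), mul_comm]

/-- Evaluation of a polynomial with coefficients in `C(X, ℝ)` at a point `x` and a number `t`. -/
noncomputable def polyEval {X : Type*} [TopologicalSpace X] (x : X) (t : ℝ) :
    Polynomial C(X, ℝ) →+* ℝ :=
  Polynomial.eval₂RingHom (ContinuousMap.evalAlgHom ℝ ℝ x : C(X, ℝ) →+* ℝ) t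

@[simp] lemma polyEval_C {X : Type*} [TopologicalSpace X] (x : X) (t : ℝ) (f : C(X, ℝ)) :
    polyEval x t (Polynomial.C f) = f x := by
  simp [polyEval]

@[simp] lemma polyEval_X {X : Type*} [TopologicalSpace X] (x : X) (t : ℝ) :
    polyEval x t Polynomial.X = t := by
  simp [polyEval]

lemma polyEval_eq_sum {X : Type*} [TopologicalSpace X] (x : X) (t : ℝ) (P : Polynomial C(X, ℝ)) :
    polyEval x t P = ∑ k ∈ range (P.natDegree + 1), P.coeff k x * t ^ k := by
  simp [polyEval, Polynomial.eval₂_eq_sum_range]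

/-- The integral over a compact set of a polynomial in `t` with continuous coefficients is a
polynomial in `t`. -/
lemma exists_polynomial_eval_eq_setIntegral {s : Set (κ → ℝ)} (hs : IsCompact s)
    (P : Polynomial C(κ → ℝ, ℝ)) :
    ∃ p : Polynomial ℝ, ∀ t, p.eval t = ∫ x in s, polyEval x t P := by
  refine ⟨∑ k ∈ range (P.natDegree + 1),
    Polynomial.C (∫ x in s, P.coeff k x) * Polynomial.X ^ k, fun t => ?_⟩
  simp only [polyEval_eq_sum]
  have hint : ∀ k ∈ range (P.natDegree + 1), IntegrableOn (fun x => P.coeff k x * t ^ k) s :=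
    fun k _ => ContinuousOn.integrableOn_compact hs (by fun_prop)
  rw [integral_finsetSum _ hint]
  simp [Polynomial.eval_finsetSum, integral_mul_const]

/-- For polynomial weights, both sides of the change of variables formula are polynomial in `t`,
so that it extends from small `t` to `t = 1`, where `x ↦ x + u(x)` need not be injective. -/
lemma setIntegral_mvPolynomial_comp_id_add {u : (κ → ℝ) → κ → ℝ} (hu : ContDiff ℝ 1 u) {R : ℝ}
    (hR : ∀ x ∉ closedBall (0 : κ → ℝ) R, u x = 0) (q : MvPolynomial κ ℝ) :
    ∫ x in closedBall 0 R, MvPolynomial.eval (x + u x) q *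
        (ContinuousLinearMap.id ℝ (κ → ℝ) + fderiv ℝ u x).det
      = ∫ x in closedBall 0 R, MvPolynomial.eval x q := by
  classical
  have hfd := hu.continuous_fderiv one_ne_zero
  let A : Matrix κ κ C(κ → ℝ, ℝ) := Matrix.of fun i j =>
    ⟨fun x => fderiv ℝ u x (Pi.single j 1) i, by fun_prop⟩
  let U : κ → C(κ → ℝ, ℝ) := fun i => ⟨fun x => u x i, by have := hu.continuous; fun_prop⟩
  let Y : κ → C(κ → ℝ, ℝ) := fun i => ⟨fun x => x i, by fun_prop⟩
  let P : Polynomial C(κ → ℝ, ℝ) :=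
    MvPolynomial.eval₂Hom (Polynomial.C.comp (algebraMap ℝ C(κ → ℝ, ℝ)))
      (fun i => Polynomial.C (Y i) + Polynomial.C (U i) * Polynomial.X) q *
    (1 + Matrix.of fun i j => Polynomial.C (A i j) * Polynomial.X).det
  have hP : ∀ x t, polyEval x t P = MvPolynomial.eval (x + t • u x) q *
      (ContinuousLinearMap.id ℝ (κ → ℝ) + t • fderiv ℝ u x).det := by
    intro x t
    simp only [P, map_mul]
    congr 1
    · rw [← RingHom.comp_apply]
      refine congrArg (fun f : MvPolynomial κ ℝ →+* ℝ => f q) ?_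
      refine MvPolynomial.ringHom_ext (fun r => ?_) fun i => ?_
      · simp
      · simpa [Y, U] using mul_comm _ _
    · rw [RingHom.map_det, ContinuousLinearMap.det, ← LinearMap.det_toMatrix']
      congr 1
      ext i j
      simpa [A, LinearMap.toMatrix'_apply, Matrix.one_apply, Pi.single_apply, apply_ite]
        using mul_comm _ _
  obtain ⟨p, hp⟩ := exists_polynomial_eval_eq_setIntegral
    (isCompact_closedBall (0 : κ → ℝ) R) P
  have hev : ∀ᶠ t : ℝ in 𝓝 0,
      p.eval t = (Polynomial.C (∫ x in closedBall 0 R, MvPolynomial.eval x q)).eval t := by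
    filter_upwards [eventually_setIntegral_comp_id_add_smul hu hR] with t ht
    simp only [hp, hP, Polynomial.eval_C]
    exact ht fun y => MvPolynomial.eval y q
  have hpc := Polynomial.eq_of_infinite_eval_eq _ _ (infinite_of_mem_nhds (0 : ℝ) hev)
  have h1 := hp 1
  rw [hpc] at h1
  simpa [hP] using h1.symm

/-- Weierstrass approximation in several variables. -/
lemma IsCompact.exists_mvPolynomial_near {s : Set (κ → ℝ)} (hs : IsCompact s)
    {ρ : (κ → ℝ) → ℝ} (hρ : Continuous ρ) {ε : ℝ} (hε : 0 < ε) :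
    ∃ q : MvPolynomial κ ℝ, ∀ x ∈ s, |MvPolynomial.eval x q - ρ x| < ε := by
  have := isCompact_iff_compactSpace.1 hs
  let φ : MvPolynomial κ ℝ →ₐ[ℝ] C(s, ℝ) :=
    MvPolynomial.aeval fun i => ⟨fun x => x.1 i, (continuous_apply i).comp continuous_subtype_val⟩
  have hφ : ∀ q (x : s), φ q x = MvPolynomial.eval x.1 q := by
    intro q x
    have : (ContinuousMap.evalAlgHom ℝ ℝ x).comp φ = MvPolynomial.aeval x.1 :=
      MvPolynomial.algHom_ext fun i => by simp [φ]
    have := congrArg (fun f => f q) this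
    simpa [MvPolynomial.aeval_eq_eval] using this
  have hsep : φ.range.SeparatesPoints := by
    intro x y hxy
    obtain ⟨i, hi⟩ : ∃ i, x.1 i ≠ y.1 i := by
      by_contra! h
      exact hxy (Subtype.ext (funext h))
    exact ⟨φ (MvPolynomial.X i), ⟨_, ⟨_, rfl⟩, rfl⟩, by simpa [hφ] using hi⟩
  obtain ⟨⟨_, q, rfl⟩, hg⟩ :=
    ContinuousMap.exists_mem_subalgebra_near_continuous_of_separatesPoints φ.range hsep
      (fun x : s => ρ x) (by fun_prop) ε hε
  refine ⟨q, fun x hx => ?_⟩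
  have := hg ⟨x, hx⟩
  simpa [hφ] using this

/-- A `C¹` map that is the identity off a ball takes the value `0`. -/
lemma exists_add_eq_zero_of_contDiff {u : (κ → ℝ) → κ → ℝ} (hu : ContDiff ℝ 1 u) {R : ℝ}
    (hRpos : 0 < R) (hR : ∀ x ∉ closedBall (0 : κ → ℝ) R, u x = 0) : ∃ x, x + u x = 0 := by
  by_contra! hne
  have hhc : Continuous fun x => x + u x := continuous_id.add hu.continuous
  have hB := isCompact_closedBall (0 : κ → ℝ) R
  obtain ⟨x₀, -, hx₀⟩ := hB.exists_isMinOn ⟨0, mem_closedBall_self hRpos.le⟩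
    hhc.norm.continuousOn
  set δ := ‖x₀ + u x₀‖ with hδ
  have hδpos : 0 < δ := norm_pos_iff.2 (hne x₀)
  -- a bump around `0` that vanishes on the image of the ball
  let ρ : (κ → ℝ) → ℝ := fun y => max 0 (δ - ‖y‖)
  have hρc : Continuous ρ := by fun_prop
  have hρ0 : ∀ y, 0 ≤ ρ y := fun y => le_max_left _ _
  have hρh : ∀ x ∈ closedBall (0 : κ → ℝ) R, ρ (x + u x) = 0 := fun x hx =>
    max_eq_left (sub_nonpos.2 (hx₀ hx))
  have hint : ∀ {f : (κ → ℝ) → ℝ}, Continuous f → IntegrableOn f (closedBall 0 R) := fun hf =>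
    hf.continuousOn.integrableOn_compact hB
  have hc : 0 < ∫ x in closedBall 0 R, ρ x := by
    rw [setIntegral_pos_iff_support_of_nonneg_ae (Filter.Eventually.of_forall hρ0) (hint hρc)]
    refine (measure_ball_pos volume (0 : κ → ℝ) (lt_min hδpos hRpos)).trans_le
      (measure_mono fun y hy => ?_)
    rw [mem_ball_zero_iff, lt_min_iff] at hy
    exact ⟨(lt_max_of_lt_right (sub_pos.2 hy.1)).ne', mem_closedBall_zero_iff.2 hy.2.le⟩
  set c := ∫ x in closedBall 0 R, ρ x
  let J : (κ → ℝ) → ℝ := fun x => (ContinuousLinearMap.id ℝ (κ → ℝ) + fderiv ℝ u x).det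
  have hJ : Continuous J := by
    have := hu.continuous_fderiv one_ne_zero
    exact ContinuousLinearMap.continuous_det.comp (by fun_prop)
  let M := ∫ x in closedBall (0 : κ → ℝ) R, (|J x| + 1)
  have hM : 0 ≤ M := integral_nonneg fun x => by positivity
  have hε : 0 < c / (M + 1) := by positivity
  set ε := c / (M + 1) with hεd
  obtain ⟨q, hq⟩ := (hB.union (hB.image hhc)).exists_mvPolynomial_near hρc hε
  have hqc : Continuous fun x => MvPolynomial.eval x q := MvPolynomial.continuous_eval q
  have hqJ : Continuous fun x => MvPolynomial.eval (x + u x) q * J x := (hqc.comp hhc).mul hJ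
  have hd : Continuous fun x =>
      MvPolynomial.eval (x + u x) q * J x - MvPolynomial.eval x q := hqJ.sub hqc
  have key := setIntegral_mvPolynomial_comp_id_add hu hR q
  have hle : c ≤ ∫ x in closedBall (0 : κ → ℝ) R, ε * (|J x| + 1) := by
    calc c = ∫ x in closedBall (0 : κ → ℝ) R, (ρ x +
          (MvPolynomial.eval (x + u x) q * J x - MvPolynomial.eval x q)) := by
          rw [integral_add (hint hρc) (hint hd), integral_sub (hint hqJ) (hint hqc),
            key, sub_self, add_zero]
      _ ≤ _ := by
          refine setIntegral_mono_on (hint (hρc.add hd))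
            (hint (by fun_prop)) measurableSet_closedBall fun x hx => ?_
          have h1 := (abs_lt.1 (hq x (Or.inl hx))).1
          have h2 := hq (x + u x) (Or.inr ⟨x, hx, rfl⟩)
          rw [hρh x hx, sub_zero] at h2
          have h3 : MvPolynomial.eval (x + u x) q * J x ≤ ε * |J x| :=
            (le_abs_self _).trans (by rw [abs_mul]; gcongr)
          linarith
  rw [integral_const_mul, hεd] at hle
  change c ≤ c / (M + 1) * M at hle
  rw [div_mul_eq_mul_div, le_div_iff₀ (by positivity)] at hle
  linarith

/-- A bounded continuous self-map of `ℝⁿ` has a fixed point (a form of Brouwer's theorem). -/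
theorem exists_fixedPoint_of_continuous_of_bounded {f : (κ → ℝ) → κ → ℝ} (hf : Continuous f)
    {R : ℝ} (hR : ∀ x, ‖f x‖ ≤ R) : ∃ x, f x = x := by
  have hR0 : 0 ≤ R := (norm_nonneg _).trans (hR 0)
  -- It suffices to find points that are moved arbitrarily little.
  suffices H : ∀ ε, 0 < ε → ε ≤ 1 → ∃ x ∈ closedBall (0 : κ → ℝ) (R + 1), ‖f x - x‖ < ε by
    obtain ⟨x₀, -, hx₀⟩ := (isCompact_closedBall (0 : κ → ℝ) (R + 1)).exists_isMinOn
      ⟨0, mem_closedBall_self (by positivity)⟩ (hf.sub continuous_id).norm.continuousOn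
    refine ⟨x₀, ?_⟩
    by_contra hne
    have hpos : 0 < ‖f x₀ - x₀‖ := norm_pos_iff.2 (sub_ne_zero.2 hne)
    obtain ⟨x, hx, hlt⟩ := H (min ‖f x₀ - x₀‖ 1) (by positivity) (min_le_right _ _)
    exact (hlt.trans_le (min_le_left _ _)).not_ge (hx₀ hx)
  intro ε hε hε1
  obtain ⟨g, hg, hgf, -⟩ := hf.exists_contDiff_approx 1 (ε := fun _ => ε) continuous_const
    fun _ => hε
  have hgR : ∀ x, ‖g x‖ ≤ R + 1 := fun x => by
    have h1 := hgf x
    rw [dist_eq_norm] at h1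
    have h2 := norm_le_norm_add_norm_sub' (g x) (f x)
    linarith [hR x]
  -- The displacement `-g` is cut off outside the ball of radius `R + 1`, which contains the
  -- values of `g`.
  let χ : ContDiffBump (0 : κ → ℝ) := ⟨R + 1, R + 2, by positivity, by linarith⟩
  obtain ⟨x, hx⟩ := exists_add_eq_zero_of_contDiff (u := fun x => -(χ x • g x)) (R := R + 2)
    ((χ.contDiff.smul (hg.of_le (by simp))).neg) (by positivity) fun x hx => by
      rw [χ.zero_of_le_dist ((not_le.1 hx).le), zero_smul, neg_zero]
  have hx' : x = χ x • g x := by rwa [← sub_eq_add_neg, sub_eq_zero] at hx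
  have hxR : ‖x‖ ≤ R + 1 := by
    rw [hx', norm_smul, Real.norm_of_nonneg χ.nonneg]
    exact (mul_le_of_le_one_left (norm_nonneg _) χ.le_one).trans (hgR x)
  have hxB : x ∈ closedBall (0 : κ → ℝ) (R + 1) := mem_closedBall_zero_iff.2 hxR
  rw [χ.one_of_mem_closedBall hxB, one_smul] at hx'
  refine ⟨x, hxB, ?_⟩
  have h1 := hgf x
  rwa [← hx', dist_comm, dist_eq_norm] at h1

end Brouwer

/-! ### Approximate equilibria of finite games in mixed strategies -/

section WeightedLotteries

open Topology

lemma prelec_nonneg (α p : ℝ) : 0 ≤ prelec α p := by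
  unfold prelec
  split_ifs
  · exact le_rfl
  · exact (Real.exp_pos _).le

lemma continuousOn_prelec {α : ℝ} (hα : 0 < α) : ContinuousOn (prelec α) (Set.Icc 0 1) := by
  intro p hp
  rcases hp.1.eq_or_lt with rfl | hp0
  · rw [← continuousWithinAt_sdiff_self]
    refine ContinuousWithinAt.mono (t := Set.Ioi 0) ?_
      fun q hq => lt_of_le_of_ne hq.1.1 (Ne.symm hq.2)
    have h : Filter.Tendsto (fun q : ℝ => Real.exp (-((-Real.log q) ^ α))) (𝓝[>] 0) (𝓝 0) :=
      Real.tendsto_exp_neg_atTop_nhds_zero.comp ((tendsto_rpow_atTop hα).comp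
        (Filter.tendsto_neg_atBot_atTop.comp Real.tendsto_log_nhdsGT_zero))
    rw [ContinuousWithinAt, show prelec α 0 = 0 from if_pos rfl]
    refine h.congr' ?_
    filter_upwards [self_mem_nhdsWithin] with q hq
    exact (if_neg (ne_of_gt hq)).symm
  · have h : ContinuousAt (fun q : ℝ => Real.exp (-((-Real.log q) ^ α))) p :=
      (((Real.continuousAt_log hp0.ne').neg.rpow_const (Or.inr hα.le)).neg).rexp
    refine (h.congr ?_).continuousWithinAt
    filter_upwards [eventually_ne_nhds hp0.ne'] with q hq
    exact (if_neg hq).symm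

/-- The form shared by both models of evaluation: the probabilities of the other players' actions
enter through a continuous nonnegative weight. The weight is extended to all of `ℝ`. -/
lemma UserModel.exists_weight {n : ℕ} (m : UserModel n) :
    ∃ w : Fin n → ℝ → ℝ, (∀ i, Continuous (w i)) ∧ (∀ i p, 0 ≤ w i p) ∧
      ∀ (I : Fin n → Type) [∀ i, Fintype (I i)] (i : Fin n) (F : (∀ j, I j) → ℝ)
        (a : ∀ j, stdSimplex ℝ (I j)),
        m.value i F a = ∑ σ : (∀ j, I j),
          F σ * ((a i).1 (σ i) * ∏ j ∈ univ.erase i, w i ((a j).1 (σ j))) := by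
  cases m with
  | expectedUtility =>
    refine ⟨fun _ p => max 0 p, fun i => by fun_prop, fun i p => le_max_left _ _,
      fun I _ i F a => sum_congr rfl fun σ _ => ?_⟩
    rw [← mul_prod_erase univ _ (mem_univ i)]
    congr 2
    exact prod_congr rfl fun j _ => (max_eq_right ((a j).2.1 _)).symm
  | prospect α hα =>
    refine ⟨fun i p => prelec (α i) (max 0 (min 1 p)), fun i => ?_, fun i p => prelec_nonneg _ _,
      fun I _ i F a => sum_congr rfl fun σ _ => ?_⟩
    · exact (continuousOn_prelec (hα i).1).comp_continuous (by fun_prop) fun p =>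
        ⟨le_max_left _ _, max_le zero_le_one (min_le_left _ _)⟩
    · congr 2
      refine prod_congr rfl fun j _ => ?_
      have h1 : (a j).1 (σ j) ≤ 1 := by
        rw [← (a j).2.2]
        exact single_le_sum (fun s _ => (a j).2.1 s) (mem_univ _)
      simp only [min_eq_right h1, max_eq_right ((a j).2.1 (σ j))]

/-- The value of a lottery is monotone in the payoffs. -/
lemma UserModel.value_mono {n : ℕ} (m : UserModel n) {I : Fin n → Type} [∀ i, Fintype (I i)]
    (i : Fin n) {F G : (∀ j, I j) → ℝ} (h : ∀ σ, F σ ≤ G σ) (a : ∀ j, stdSimplex ℝ (I j)) :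
    m.value i F a ≤ m.value i G a := by
  obtain ⟨w, -, hw, hv⟩ := m.exists_weight
  rw [hv, hv]
  exact sum_le_sum fun σ _ => mul_le_mul_of_nonneg_right (h σ)
    (mul_nonneg ((a i).2.1 _) (prod_nonneg fun j _ => hw i _))

/-- Given the other players' mixed strategies, the value of a lottery is linear in the player's
own probabilities. -/
lemma UserModel.exists_value_eq_sum {n : ℕ} (m : UserModel n) {I : Fin n → Type}
    [∀ i, Fintype (I i)] (F : Fin n → (∀ j, I j) → ℝ) :
    ∃ c : ∀ i, I i → ((Σ j, I j) → ℝ) → ℝ, (∀ i s, Continuous (c i s)) ∧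
      ∀ (a : ∀ j, stdSimplex ℝ (I j)) (i : Fin n) (b : stdSimplex ℝ (I i)),
        m.value i (F i) (Function.update a i b) =
          ∑ s, b.1 s * c i s (fun k => (a k.1).1 k.2) := by
  classical
  obtain ⟨w, hwc, -, hv⟩ := m.exists_weight
  refine ⟨fun i s x => ∑ σ : (∀ j, I j) with σ i = s,
    F i σ * ∏ j ∈ univ.erase i, w i (x ⟨j, σ j⟩), fun i s => ?_, fun a i b => ?_⟩
  · have := hwc i
    fun_prop
  · rw [hv, ← sum_fiberwise univ (fun σ : (∀ j, I j) => σ i)]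
    refine sum_congr rfl fun s _ => ?_
    rw [mul_sum]
    refine sum_congr rfl fun σ hσ => ?_
    have hs : σ i = s := (mem_filter.1 hσ).2
    rw [Function.update_self, hs, mul_left_comm]
    congr 2
    refine prod_congr rfl fun j hj => ?_
    rw [Function.update_of_ne (ne_of_mem_erase hj)]

/-- A finite game has an `ε`-Nash equilibrium in mixed strategies: Brouwer's theorem is applied to
the map that plays each action with probability proportional to the amount by which its value
exceeds `max - ε`, so that only `ε`-best responses are ever played. -/
theorem UserModel.exists_isEpsNash_value {n : ℕ} (m : UserModel n) {I : Fin n → Type}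
    [∀ i, Fintype (I i)] [∀ i, Nonempty (I i)] (F : Fin n → (∀ j, I j) → ℝ) {ε : ℝ}
    (hε : 0 < ε) :
    ∃ a : ∀ j, stdSimplex ℝ (I j),
      IsEpsNash (A := fun j => stdSimplex ℝ (I j)) (fun i a => m.value i (F i) a) ε a := by
  obtain ⟨c, hc, hv⟩ := m.exists_value_eq_sum F
  let M : ∀ i, ((Σ j, I j) → ℝ) → ℝ := fun i x => univ.sup' univ_nonempty fun s => c i s x
  have hMc : ∀ i, Continuous (M i) := fun i =>
    Continuous.finset_sup'_apply univ_nonempty fun s _ => hc i s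
  have hcM : ∀ i s x, c i s x ≤ M i x := fun i s x =>
    le_sup' (fun s => c i s x) (mem_univ s)
  let e : ∀ i, I i → ((Σ j, I j) → ℝ) → ℝ := fun i s x => max 0 (c i s x - M i x + ε)
  have hec : ∀ i s, Continuous (e i s) := fun i s => by
    have := hc i s
    have := hMc i
    fun_prop
  have he : ∀ i s x, 0 ≤ e i s x := fun i s x => le_max_left _ _
  have hsum : ∀ i x, 0 < ∑ s, e i s x := fun i x => by
    obtain ⟨s, -, hs⟩ := exists_mem_eq_sup' univ_nonempty fun s => c i s x
    refine sum_pos' (fun s _ => he i s x) ⟨s, mem_univ s, lt_max_of_lt_right ?_⟩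
    change 0 < c i s x - M i x + ε
    rw [show M i x = c i s x from hs, sub_self, zero_add]
    exact hε
  obtain ⟨x, hx⟩ := exists_fixedPoint_of_continuous_of_bounded
    (f := fun x k => e k.1 k.2 x / ∑ s, e k.1 s x) (R := 1)
    (continuous_pi fun k => (hec k.1 k.2).div (continuous_finsetSum _ fun s _ => hec k.1 s)
      fun x => (hsum k.1 x).ne')
    fun x => (pi_norm_le_iff_of_nonneg zero_le_one).2 fun k => by
      rw [Real.norm_of_nonneg (div_nonneg (he _ _ _) (hsum _ _).le), div_le_one (hsum _ _)]
      exact single_le_sum (fun s _ => he k.1 s x) (mem_univ k.2)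
  have hxk : ∀ i s, x ⟨i, s⟩ = e i s x / ∑ s, e i s x := fun i s => (congrFun hx ⟨i, s⟩).symm
  let a : ∀ j, stdSimplex ℝ (I j) := fun j => ⟨fun s => x ⟨j, s⟩,
    fun s => by
      simp only [hxk]
      exact div_nonneg (he _ _ _) (hsum _ _).le,
    by
      simp_rw [hxk]
      rw [← sum_div, div_self (hsum j x).ne']⟩
  refine ⟨a, fun i b => ?_⟩
  have hself := hv a i (a i)
  rw [Function.update_eq_self] at hself
  simp only
  rw [hself, hv a i b]
  change _ ≥ ∑ s, b.1 s * c i s x - ε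
  change ∑ s, x ⟨i, s⟩ * c i s x ≥ _
  have h1 : ∑ s, b.1 s * c i s x ≤ M i x := by
    calc ∑ s, b.1 s * c i s x ≤ ∑ s, b.1 s * M i x :=
          sum_le_sum fun s _ => mul_le_mul_of_nonneg_left (hcM i s x) (b.2.1 s)
      _ = M i x := by rw [← sum_mul, b.2.2, one_mul]
  have h2 : M i x - ε ≤ ∑ s, x ⟨i, s⟩ * c i s x := by
    calc M i x - ε = ∑ s, x ⟨i, s⟩ * (M i x - ε) := by
          rw [← sum_mul, show ∑ s, x ⟨i, s⟩ = 1 from (a i).2.2, one_mul]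
      _ ≤ _ := by
          refine sum_le_sum fun s _ => ?_
          rcases le_or_gt (c i s x - M i x + ε) 0 with h | h
          · have h0 : e i s x = 0 := max_eq_left h
            rw [hxk, h0, zero_div, zero_mul, zero_mul]
          · exact mul_le_mul_of_nonneg_left (by linarith) ((a i).2.1 s)
  linarith

end WeightedLotteries

/-! ### The equilibrium of the second-stage game -/

lemma Finset.sum_apply_update {n : ℕ} {β : Fin n → Type*} (x : ∀ j, β j) (i : Fin n) (y : β i)
    (f : ∀ j, β j → ℝ) :
    ∑ j, f j (Function.update x i y j) = ∑ j, f j (x j) + (f i y - f i (x i)) := by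
  rw [← add_sum_erase univ _ (mem_univ i), ← add_sum_erase univ (fun j => f j (x j)) (mem_univ i),
    Function.update_self,
    sum_congr rfl fun j hj => by rw [Function.update_of_ne (ne_of_mem_erase hj)]]
  ring

namespace EVSystem

variable (S : EVSystem)

lemma target_denominator_pos (t : Fin S.T) : 0 < (S.T - (((t : ℕ) : ℝ) + 1)) + 1 := by
  have : ((t : ℕ) : ℝ) < S.T := by exact_mod_cast t.2
  linarith

lemma deviationCost_eq (i : Fin S.N) (t₀ : Fin S.T) (x : Fin S.T → ℝ) (t : Fin S.T) :
    S.deviationCost i t₀ x t = S.g i t * max 0 (S.target i t₀ x t - x t) ^ 2 := by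
  unfold deviationCost
  split_ifs with h
  · rw [max_eq_right (sub_nonneg.2 h.le)]
  · rw [max_eq_left (sub_nonpos.2 (not_lt.1 h))]
    simp

@[fun_prop]
lemma continuous_deviationCost (i : Fin S.N) (t₀ t : Fin S.T) :
    Continuous fun x => S.deviationCost i t₀ x t := by
  simp only [deviationCost_eq, target]
  fun_prop

lemma target_convexComb (i : Fin S.N) (t₀ : Fin S.T) (x y : Fin S.T → ℝ) (s : ℝ) (t : Fin S.T) :
    S.target i t₀ (fun t => x t + s * (y t - x t)) t =
      (1 - s) * S.target i t₀ x t + s * S.target i t₀ y t := by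
  have := (S.target_denominator_pos t).ne'
  simp only [target, sum_add_distrib, ← mul_sum, sum_sub_distrib]
  field_simp
  ring

/-- The deviation cost is convex in the charging profile. -/
lemma deviationCost_convexComb_le (i : Fin S.N) (t₀ : Fin S.T) (x y : Fin S.T → ℝ) {s : ℝ}
    (hs0 : 0 ≤ s) (hs1 : s ≤ 1) (t : Fin S.T) :
    S.deviationCost i t₀ (fun t => x t + s * (y t - x t)) t ≤
      S.deviationCost i t₀ x t + s * (S.deviationCost i t₀ y t - S.deviationCost i t₀ x t) := by
  simp only [deviationCost_eq, target_convexComb]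
  set p := S.target i t₀ x t - x t with hp
  set q := S.target i t₀ y t - y t with hq
  have h1 : (1 - s) * S.target i t₀ x t + s * S.target i t₀ y t - (x t + s * (y t - x t)) =
      (1 - s) * p + s * q := by rw [hp, hq]; ring
  rw [h1]
  have hg := (S.g_pos i t).le
  have hm : max 0 ((1 - s) * p + s * q) ≤ (1 - s) * max 0 p + s * max 0 q := by
    have h0 : 0 ≤ 1 - s := sub_nonneg.2 hs1
    refine max_le (by positivity) ?_
    gcongr
    · exact le_max_right _ _
    · exact le_max_right _ _
  have h2 : max 0 ((1 - s) * p + s * q) ^ 2 ≤ ((1 - s) * max 0 p + s * max 0 q) ^ 2 :=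
    pow_le_pow_left₀ (le_max_left _ _) hm 2
  have h3 : ((1 - s) * max 0 p + s * max 0 q) ^ 2 ≤
      max 0 p ^ 2 + s * (max 0 q ^ 2 - max 0 p ^ 2) := by
    nlinarith [mul_nonneg (mul_nonneg hs0 (sub_nonneg.2 hs1)) (sq_nonneg (max 0 p - max 0 q))]
  nlinarith [mul_le_mul_of_nonneg_left (h2.trans h3) hg]

/-- Total deviation cost of an aggregator. -/
noncomputable def totalDeviation (σ : S.StartProfile) (i : Fin S.N) (x : Fin S.T → ℝ) : ℝ :=
  ∑ t ∈ Ici (σ i).1, S.deviationCost i (σ i).1 x t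

lemma totalDeviation_convexComb_le (σ : S.StartProfile) (i : Fin S.N) (x y : Fin S.T → ℝ) {s : ℝ}
    (hs0 : 0 ≤ s) (hs1 : s ≤ 1) :
    S.totalDeviation σ i (fun t => x t + s * (y t - x t)) ≤
      S.totalDeviation σ i x + s * (S.totalDeviation σ i y - S.totalDeviation σ i x) := by
  unfold totalDeviation
  rw [← sum_sub_distrib, mul_sum, ← sum_add_distrib]
  exact sum_le_sum fun t _ => S.deviationCost_convexComb_le i _ x y hs0 hs1 t

/-- Feasible profiles vanish before the start, so the energy costs may be summed over all slots. -/
lemma cost_eq (σ : S.StartProfile) (i : Fin S.N) (x : Fin S.N → Fin S.T → ℝ)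
    (hx : x i ∈ S.chargingSet i (σ i).1) :
    S.cost σ i x = ∑ t, S.price x t * x i t + S.totalDeviation σ i (x i) := by
  unfold cost totalDeviation
  rw [sum_add_distrib]
  congr 1
  refine sum_subset (subset_univ _) fun t _ ht => ?_
  rw [hx.1 t (not_le.1 fun h => ht (mem_Ici.2 h)), mul_zero]

lemma isCompact_chargingSet (i : Fin S.N) (t₀ : Fin S.T) : IsCompact (S.chargingSet i t₀) := by
  have hη := S.eta_pos i
  have hdt := S.dt_pos
  refine (isCompact_univ_pi fun _ : Fin S.T =>
    isCompact_Icc (a := (0 : ℝ)) (b := (∑ v, S.R i v) * S.dt / S.eta i)).of_isClosed_subset ?_ ?_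
  · have h1 : IsClosed {x : Fin S.T → ℝ | ∀ t, t < t₀ → x t = 0} := by
      simp only [Set.ofPred_forall]
      exact isClosed_iInter fun t => isClosed_iInter fun _ =>
        isClosed_eq (continuous_apply t) continuous_const
    have h2 : IsClosed {x : Fin S.T → ℝ | ∑ t, S.eta i * x t = S.demand i} :=
      isClosed_eq (by fun_prop) continuous_const
    have h3 : IsClosed {x : Fin S.T → ℝ | ∀ t, 0 ≤ S.eta i * x t / S.dt ∧
        S.eta i * x t / S.dt ≤ ∑ v, S.R i v} := by
      simp only [Set.ofPred_forall, Set.ofPred_and]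
      exact isClosed_iInter fun t => (isClosed_le continuous_const (by fun_prop)).inter
        (isClosed_le (by fun_prop) continuous_const)
    exact h1.inter (h2.inter h3)
  · rintro x ⟨-, -, h⟩ t -
    obtain ⟨h0, h1⟩ := h t
    constructor
    · rw [le_div_iff₀ hdt, zero_mul] at h0
      exact nonneg_of_mul_nonneg_right h0 hη
    · rw [div_le_iff₀ hdt] at h1
      rw [le_div_iff₀ hη, mul_comm]
      exact h1

lemma convexComb_mem_chargingSet (i : Fin S.N) (t₀ : Fin S.T) {x y : Fin S.T → ℝ}
    (hx : x ∈ S.chargingSet i t₀) (hy : y ∈ S.chargingSet i t₀) {s : ℝ} (hs0 : 0 ≤ s)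
    (hs1 : s ≤ 1) : (fun t => x t + s * (y t - x t)) ∈ S.chargingSet i t₀ := by
  have hs : 0 ≤ 1 - s := sub_nonneg.2 hs1
  have hl : ∀ t, S.eta i * (x t + s * (y t - x t)) =
      (1 - s) * (S.eta i * x t) + s * (S.eta i * y t) := fun t => by ring
  refine ⟨fun t ht => by simp [hx.1 t ht, hy.1 t ht], ?_, fun t => ?_⟩
  · simp only [hl, sum_add_distrib, ← mul_sum _ _ s, ← mul_sum _ _ (1 - s), hx.2.1, hy.2.1]
    ring
  · have e : S.eta i * (x t + s * (y t - x t)) / S.dt =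
        (1 - s) * (S.eta i * x t / S.dt) + s * (S.eta i * y t / S.dt) := by rw [hl]; ring
    obtain ⟨hx0, hx1⟩ := hx.2.2 t
    obtain ⟨hy0, hy1⟩ := hy.2.2 t
    simp only [e]
    exact ⟨by positivity, by nlinarith⟩

/-- An exact potential of the second-stage game. -/
noncomputable def potential (σ : S.StartProfile) (x : Fin S.N → Fin S.T → ℝ) : ℝ :=
  ∑ t, (S.phi t * (S.baseLoad t * ∑ i, x i t + (∑ i, x i t ^ 2) / 2 + (∑ i, x i t) ^ 2 / 2) +
    S.delta t * ∑ i, x i t) + ∑ i, S.totalDeviation σ i (x i)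

lemma continuous_potential (σ : S.StartProfile) : Continuous (S.potential σ) := by
  unfold potential totalDeviation
  refine Continuous.add (by fun_prop) ?_
  refine continuous_finsetSum _ fun i _ => continuous_finsetSum _ fun t _ => ?_
  exact (S.continuous_deviationCost i _ t).comp (continuous_apply i)

lemma potential_update_sub (σ : S.StartProfile) (x : Fin S.N → Fin S.T → ℝ) (i : Fin S.N)
    (y : Fin S.T → ℝ) (hx : x i ∈ S.chargingSet i (σ i).1) (hy : y ∈ S.chargingSet i (σ i).1) :
    S.potential σ (Function.update x i y) - S.potential σ x =
      S.cost σ i (Function.update x i y) - S.cost σ i x := by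
  rw [S.cost_eq σ i x hx, S.cost_eq σ i _ (by rwa [Function.update_self]), Function.update_self]
  have hdev : ∑ j, S.totalDeviation σ j (Function.update x i y j) =
      ∑ j, S.totalDeviation σ j (x j) +
        (S.totalDeviation σ i y - S.totalDeviation σ i (x i)) :=
    sum_apply_update x i y fun j => S.totalDeviation σ j
  have h1 : ∀ t, ∑ j, Function.update x i y j t = ∑ j, x j t + (y t - x i t) := fun t =>
    sum_apply_update x i y fun _ z => z t
  have h2 : ∀ t, ∑ j, Function.update x i y j t ^ 2 = ∑ j, x j t ^ 2 + (y t ^ 2 - x i t ^ 2) :=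
    fun t => sum_apply_update x i y fun _ z => z t ^ 2
  unfold potential price
  simp only [hdev, h1, h2]
  rw [add_sub_add_comm, add_sub_add_comm, ← sum_sub_distrib, ← sum_sub_distrib]
  congr 1
  · exact sum_congr rfl fun t _ => by ring
  · ring

lemma coe_update {σ : S.StartProfile} (x : ∀ j, S.Charging σ j) (i : Fin S.N)
    (y : S.Charging σ i) :
    (fun j => (Function.update x i y j).1) = Function.update (fun j => (x j).1) i y.1 := by
  funext j
  rcases eq_or_ne j i with rfl | h
  · simp
  · simp [h]

/-- A minimizer of the potential is a Nash equilibrium. -/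
theorem exists_isNash_subgamePayoff (σ : S.StartProfile) :
    ∃ x : ∀ j, S.Charging σ j, IsNash (S.subgamePayoff σ) x := by
  have : ∀ j, CompactSpace (S.Charging σ j) := fun j =>
    isCompact_iff_compactSpace.1 (S.isCompact_chargingSet j _)
  have hc : Continuous fun x : ∀ j, S.Charging σ j => S.potential σ fun j => (x j).1 :=
    (S.continuous_potential σ).comp
      (continuous_pi fun j => continuous_subtype_val.comp (continuous_apply j))
  obtain ⟨x, -, hx⟩ := isCompact_univ.exists_isMinOn Set.univ_nonempty hc.continuousOn
  refine ⟨x, fun i y => ?_⟩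
  have h := hx (Set.mem_univ (Function.update x i y))
  simp only [Set.mem_ofPred_eq] at h
  unfold subgamePayoff
  rw [coe_update] at h ⊢
  have := S.potential_update_sub σ (fun j => (x j).1) i y.1 (x i).2 y.2
  linarith

/-- First-order condition at a Nash equilibrium: the derivative of the smooth part of the cost in
a feasible direction, plus the increment of the convex part, is nonnegative. -/
lemma variational_inequality_of_isNash {σ : S.StartProfile} {x : ∀ j, S.Charging σ j}
    (hx : IsNash (S.subgamePayoff σ) x) (i : Fin S.N) (y : S.Charging σ i) :
    0 ≤ ∑ t, (S.price (fun j => (x j).1) t + S.phi t * (x i).1 t) * (y.1 t - (x i).1 t) +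
      (S.totalDeviation σ i y.1 - S.totalDeviation σ i (x i).1) := by
  set X : Fin S.N → Fin S.T → ℝ := fun j => (x j).1 with hX
  set A := ∑ t, (S.price X t + S.phi t * X i t) * (y.1 t - X i t) +
    (S.totalDeviation σ i y.1 - S.totalDeviation σ i (X i))
  set B := ∑ t, S.phi t * (y.1 t - X i t) ^ 2 with hB
  have hB0 : 0 ≤ B := sum_nonneg fun t _ => mul_nonneg (S.phi_pos t).le (sq_nonneg _)
  change 0 ≤ A
  -- Moving a fraction `s` of the way towards `y` costs at most `s A + s² B`.
  have key : ∀ s : ℝ, 0 ≤ s → s ≤ 1 → 0 ≤ s * A + s ^ 2 * B := by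
    intro s hs0 hs1
    have hz := S.convexComb_mem_chargingSet i _ (x i).2 y.2 hs0 hs1
    have h := hx i ⟨_, hz⟩
    unfold subgamePayoff at h
    rw [coe_update, ← hX] at h
    have h1 := S.cost_eq σ i X (x i).2
    have h2 := S.cost_eq σ i (Function.update X i fun t => X i t + s * (y.1 t - X i t))
      (by rw [Function.update_self]; exact hz)
    rw [Function.update_self] at h2
    have h3 := S.totalDeviation_convexComb_le σ i (X i) y.1 hs0 hs1
    have h4 : ∑ t, S.price (Function.update X i fun t => X i t + s * (y.1 t - X i t)) t *
        (X i t + s * (y.1 t - X i t)) = ∑ t, S.price X t * X i t +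
        s * ∑ t, (S.price X t + S.phi t * X i t) * (y.1 t - X i t) + s ^ 2 * B := by
      rw [hB, mul_sum, mul_sum, ← sum_add_distrib, ← sum_add_distrib]
      refine sum_congr rfl fun t _ => ?_
      simp only [price]
      rw [sum_apply_update X i _ fun _ z => z t]
      ring
    change -S.cost σ i X ≥ -S.cost σ i
      (Function.update X i fun t => X i t + s * (y.1 t - X i t)) at h
    simp only [A]
    nlinarith
  by_contra! hA
  have hs0 : 0 < min 1 (-A / (2 * (B + 1))) :=
    lt_min one_pos (div_pos (neg_pos.2 hA) (by positivity))
  have h := key _ hs0.le (min_le_left _ _)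
  have hs1 : min 1 (-A / (2 * (B + 1))) * (2 * (B + 1)) ≤ -A :=
    (le_div_iff₀ (by positivity)).1 (min_le_right _ _)
  nlinarith

/-- Uniqueness of the equilibrium: the pseudogradient of the costs is strictly monotone. -/
theorem eq_of_isNash_subgamePayoff {σ : S.StartProfile} {x y : ∀ j, S.Charging σ j}
    (hx : IsNash (S.subgamePayoff σ) x) (hy : IsNash (S.subgamePayoff σ) y) : x = y := by
  have h1 := sum_nonneg fun i (_ : i ∈ univ) => S.variational_inequality_of_isNash hx i (y i)
  have h2 := sum_nonneg fun i (_ : i ∈ univ) => S.variational_inequality_of_isNash hy i (x i)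
  have h3 : (∑ t, S.phi t * ((∑ i, ((x i).1 t - (y i).1 t)) ^ 2 +
      ∑ i, ((x i).1 t - (y i).1 t) ^ 2)) ≤ 0 := by
    rw [← neg_nonneg]
    refine (add_nonneg h1 h2).trans_eq ?_
    rw [← sum_add_distrib]
    simp only [add_add_add_comm _ (S.totalDeviation σ _ _ - _), sub_add_sub_cancel, sub_self,
      add_zero, ← sum_add_distrib]
    rw [sum_comm, ← sum_neg_distrib]
    refine sum_congr rfl fun t _ => ?_
    have e : ∀ i, (S.price (fun j => (x j).1) t + S.phi t * (x i).1 t) *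
          ((y i).1 t - (x i).1 t) +
        (S.price (fun j => (y j).1) t + S.phi t * (y i).1 t) * ((x i).1 t - (y i).1 t) =
        -(S.phi t * ((∑ j, ((x j).1 t - (y j).1 t)) * ((x i).1 t - (y i).1 t) +
          ((x i).1 t - (y i).1 t) ^ 2)) := fun i => by
      simp only [price, sum_sub_distrib]
      ring
    simp only [e]
    rw [sum_neg_distrib, ← mul_sum, sum_add_distrib, ← mul_sum, sq (∑ i, _)]
  have hterm : ∀ t, 0 ≤ S.phi t * ((∑ i, ((x i).1 t - (y i).1 t)) ^ 2 +
      ∑ i, ((x i).1 t - (y i).1 t) ^ 2) := fun t =>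
    mul_nonneg (S.phi_pos t).le (add_nonneg (sq_nonneg _) (sum_nonneg fun i _ => sq_nonneg _))
  have h4 := (sum_eq_zero_iff_of_nonneg fun t _ => hterm t).1
    (h3.antisymm (sum_nonneg fun t _ => hterm t))
  funext i
  refine Subtype.ext (funext fun t => ?_)
  have h5 := (mul_eq_zero_iff_left (S.phi_pos t).ne').1 (h4 t (mem_univ t))
  have h6 : ∑ i, ((x i).1 t - (y i).1 t) ^ 2 = 0 := by
    have := sum_nonneg fun i (_ : i ∈ univ) => sq_nonneg ((x i).1 t - (y i).1 t)
    nlinarith [sq_nonneg (∑ i, ((x i).1 t - (y i).1 t))]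
  have h7 := (sum_eq_zero_iff_of_nonneg fun i _ => sq_nonneg _).1 h6 i (mem_univ i)
  exact sub_eq_zero.1 (pow_eq_zero_iff two_ne_zero |>.1 h7)

lemma isNash_equilibriumCharging (σ : S.StartProfile) :
    IsNash (S.subgamePayoff σ) (S.equilibriumCharging σ) :=
  Classical.epsilon_spec (S.exists_isNash_subgamePayoff σ)

end EVSystem

/-! ### From the first-stage game to the two-stage game -/

namespace EVSystem

variable (S : EVSystem)

instance startTimeNonempty (i : Fin S.N) : Nonempty (S.StartTime i) := by
  have hτ : S.minSlots i ≤ S.T := Real.iSup_le (S.chargeable i) (Nat.cast_nonneg _)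
  refine ⟨⟨⟨0, S.T_pos⟩, ?_⟩⟩
  simp only [startTimes, mem_filter, mem_univ, true_and, CharP.cast_eq_zero]
  linarith

/-- A joint deviation in both stages is no better than the deviation of the lottery alone, since
deviating from the equilibrium of a subgame does not pay and the lottery weights are
nonnegative. -/
theorem isSubgamePerfectEpsNash_followedByEquilibrium (m : UserModel S.N) {ε : ℝ} (hε : 0 ≤ ε)
    {a : ∀ j, S.Mixed j} (ha : IsEpsNash (S.mixedPayoff m) ε a) :
    S.IsSubgamePerfectEpsNash m ε (S.followedByEquilibrium a) := by
  refine ⟨fun i s' => ?_, fun σ i y => ?_⟩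
  · have hstart : (fun j => (Function.update (S.followedByEquilibrium a) i s' j).start) =
        Function.update a i s'.start := by
      funext j
      rcases eq_or_ne j i with rfl | h
      · simp
      · simp [h, followedByEquilibrium]
    have hplan : ∀ σ, (fun j => (Function.update (S.followedByEquilibrium a) i s' j).plan σ) =
        Function.update (S.equilibriumCharging σ) i (s'.plan σ) := fun σ => by
      funext j
      rcases eq_or_ne j i with rfl | h
      · simp
      · simp [h, followedByEquilibrium]
    have h1 : S.payoff m i (Function.update (S.followedByEquilibrium a) i s') ≤
        S.mixedPayoff m i (Function.update a i s'.start) := by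
      unfold payoff mixedPayoff
      rw [hstart]
      refine m.value_mono i (fun σ => ?_) _
      rw [hplan]
      exact S.isNash_equilibriumCharging σ i (s'.plan σ)
    have h2 : S.payoff m i (S.followedByEquilibrium a) = S.mixedPayoff m i a := rfl
    have h3 := ha i s'.start
    linarith
  · have h : S.subgamePayoff σ i (S.equilibriumCharging σ) ≥ _ :=
      S.isNash_equilibriumCharging σ i y
    exact (sub_le_self _ hε).trans h

end EVSystem

theorem mainTheorem3 (S : EVSystem) :
    (∀ σ : S.StartProfile, IsNash (S.subgamePayoff σ) (S.equilibriumCharging σ) ∧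
      ∀ x : (∀ j, S.Charging σ j), IsNash (S.subgamePayoff σ) x → x = S.equilibriumCharging σ) ∧
    ∀ (m : UserModel S.N) (ε : ℝ), 0 < ε →
      (∀ a : (∀ j, S.Mixed j), IsEpsNash (S.mixedPayoff m) ε a →
        S.IsSubgamePerfectEpsNash m ε (S.followedByEquilibrium a)) ∧
      (∃ a : (∀ j, S.Mixed j), IsEpsNash (S.mixedPayoff m) ε a) ∧
      ∃ s : (∀ j, S.Strategy j), S.IsSubgamePerfectEpsNash m ε s := by
  refine ⟨fun σ => ⟨S.isNash_equilibriumCharging σ, fun x hx =>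
    S.eq_of_isNash_subgamePayoff hx (S.isNash_equilibriumCharging σ)⟩, fun m ε hε => ?_⟩
  obtain ⟨a, ha⟩ := m.exists_isEpsNash_value S.firstStagePayoff hε
  exact ⟨fun b hb => S.isSubgamePerfectEpsNash_followedByEquilibrium m hε.le hb, ⟨a, ha⟩,
    _, S.isSubgamePerfectEpsNash_followedByEquilibrium m hε.le ha⟩
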